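/- Let $G\in\mathbb{S}[\mathbf{x}]^{q}$ be a symmetric polynomial matrix in $\mathbf{x}=(x_1,\dots,x_n)$ with real coefficients $G_\gamma$, let $\mathcal{X}=\{\mathbf{x}\in\mathbb{R}^n: G(\mathbf{x})\succeq 0\}$ and $d_G=\lceil \deg(G)/2\rceil$, and assume $d_G\ge 1$. Let $k\ge d_G$ and let $\mathbf{S}=(S_\alpha)_{|\alpha|\le 2k}$ be a sequence of real symmetric $m\times m$ matrices. For $d\le k$ let $M_d(\mathbf{S})=(S_{\alpha+\beta})_{|\alpha|,|\beta|\le d}$ be the moment matrix and let $M_{k-d_G}(G\mathbf{S})=\bigl(\sum_{\gamma}S_{\alpha+\beta+\gamma}\otimes G_\gamma\bigr)_{|\alpha|,|\beta|\le k-d_G}$ be the localizing matrix. Assume the flat extension condition $$M_k(\mathbf{S})\succeq 0,\qquad M_{k-d_G}(G\mathbf{S})\succeq 0,\qquad t:=\operatorname{rank}M_k(\mathbf{S})=\operatorname{rank}M_{k-d_G}(\mathbf{S}).$$ Call $\Phi=\sum_{i=1}^r W_i\,\delta_{\mathbf{x}^{(i)}}$ a minimal representing measure of $\mathbf{S}$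 if the $\mathbf{x}^{(i)}\in\mathcal{X}$ are distinct, the $W_i$ are nonzero positive semidefinite real $m\times m$ matrices, $S_\alpha=\int \mathbf{x}^\alpha\,d\Phi$ for all $|\alpha|\le 2k$, and $\sum_i\operatorname{rank}W_i=t$. Then a minimal representing measure exists, and for every minimal representing measure the following holds. Order the rows of $M_k(\mathbf{S})$, which are indexed by the monomials $\mathbf{x}^\alpha w_j$ ($|\alpha|\le k$, $1\le j\le m$, with $\mathbf{w}=(w_1,\dots,w_m)$), as in $(\mathbf{w},x_1\mathbf{w},\dots,x_n\mathbf{w},x_1^2\mathbf{w},x_1x_2\mathbf{w},\dots,x_n^k\mathbf{w})$. Let $M_k(\mathbf{S})=\widetilde V\widetilde V^{\top}$ be any factorization in which $\widetilde V$ has $t$ columns, let $U$ be the reduced column echelon form of $\widetilde V$, and let $b_k(\mathbf{x},\mathbf{w})$ be the vector of the $t$ monomials at the pivot rows of $U$. 1. Every monomial $\mathbf{x}^\alpha w_j$ in $b_k$ satisfies $|\alpha|\le k-d_G$. Hence for $l=1,\dots,n$ there is a $t\times t$ matrix $N_l$, the multiplication matrix, whose row at the basis monomial $\mathbf{x}^\alpha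 w_j$ is the row of $U$ at $x_l\mathbf{x}^\alpha w_j$. 2. For all decompositions $W_i=\sum_{j=1}^{\operatorname{rank}W_i}\mathbf{w}^{(i,j)}(\mathbf{w}^{(i,j)})^{\top}$, one has $N_l\,b_k(\mathbf{x}^{(i)},\mathbf{w}^{(i,j)})=x^{(i)}_l\,b_k(\mathbf{x}^{(i)},\mathbf{w}^{(i,j)})$ for all $i,j,l$, and the vectors $b_k(\mathbf{x}^{(i)},\mathbf{w}^{(i,j)})$, $1\le i\le r$, $1\le j\le\operatorname{rank}W_i$, are linearly independent. 3. Let $c_1,\dots,c_n>0$ with $\sum_l c_l=1$ be such that $h(\mathbf{x})=\sum_l c_lx_l$ takes distinct values at $\mathbf{x}^{(1)},\dots,\mathbf{x}^{(r)}$, and put $N=\sum_l c_lN_l$. Then $N$ has an ordered real Schur decomposition $N=ATA^{\top}$, that is, $A=[a_1,\dots,a_t]$ is orthogonal and $T$ is upper triangular with nondecreasing diagonal. For every such decomposition, the set of the points $(a_j^{\top}N_1a_j,\dots,a_j^{\top}N_na_j)$, $j=1,\dots,t$, is exactly $\{\mathbf{x}^{(1)},\dots,\mathbf{x}^{(r)}\}$,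 and each $\mathbf{x}^{(i)}$ occurs for exactly $\operatorname{rank}W_i$ indices $j$. -/

import Mathlib

open MeasureTheory

noncomputable section

namespace MatrixMoment

/-- The index set `ℕⁿ_k` of exponents `α` with `|α| ≤ k`. -/
abbrev Expo (n k : ℕ) : Type := {α : Fin n →₀ ℕ // α.degree ≤ k}

instance instFintypeExpo (n k : ℕ) : Fintype (Expo n k) :=
  @Fintype.ofFinite _ (Finsupp.finite_of_degree_le (σ := Fin n) k).to_subtype

/-- The monomial function `x ↦ x^α`. -/
def mon {n : ℕ} (α : Fin n →₀ ℕ) (x : Fin n → ℝ) : ℝ := ∏ l, x l ^ α l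

/-- The degree of a polynomial matrix: the maximal degree of its entries. -/
def matDegree {n q : ℕ} (G : Matrix (Fin q) (Fin q) (MvPolynomial (Fin n) ℝ)) : ℕ :=
  Finset.univ.sup fun ab : Fin q × Fin q => (G ab.1 ab.2).totalDegree

/-- `d_G = ⌈deg G / 2⌉`. -/
def halfDegree {n q : ℕ} (G : Matrix (Fin q) (Fin q) (MvPolynomial (Fin n) ℝ)) : ℕ :=
  (matDegree G + 1) / 2

/-- The exponents of the monomials that appear in some entry of `G`. -/
def matSupport {n q : ℕ} (G : Matrix (Fin q) (Fin q) (MvPolynomial (Fin n) ℝ)) :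
    Finset (Fin n →₀ ℕ) :=
  Finset.univ.biUnion fun ab : Fin q × Fin q => (G ab.1 ab.2).support

/-- The set `{x | G(x) ⪰ 0}`. -/
def feasibleSet {n q : ℕ} (G : Matrix (Fin q) (Fin q) (MvPolynomial (Fin n) ℝ)) :
    Set (Fin n → ℝ) :=
  {x | (G.map (MvPolynomial.eval x)).PosSemidef}

/-- The moment matrix `M_k(S)`: its `(α, β)` block is `S_{α+β}`, for `|α|, |β| ≤ k`.
Only the matrices `S_γ` with `|γ| ≤ 2k` enter. -/
def momentMatrix {n m : ℕ} (S : (Fin n →₀ ℕ) → Matrix (Fin m) (Fin m) ℝ) (k : ℕ) :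
    Matrix (Expo n k × Fin m) (Expo n k × Fin m) ℝ :=
  Matrix.of fun r s => S (r.1.1 + s.1.1) r.2 s.2

/-- The localizing matrix `M_k(GS)`: its `(α, β)` block is `∑_γ S_{α+β+γ} ⊗ G_γ`. -/
def localizingMatrix {n m q : ℕ} (G : Matrix (Fin q) (Fin q) (MvPolynomial (Fin n) ℝ))
    (S : (Fin n →₀ ℕ) → Matrix (Fin m) (Fin m) ℝ) (k : ℕ) :
    Matrix (Expo n k × (Fin m × Fin q)) (Expo n k × (Fin m × Fin q)) ℝ :=
  Matrix.of fun r s =>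
    (∑ γ ∈ matSupport G,
      Matrix.kronecker (S (r.1.1 + s.1.1 + γ)) (G.map (MvPolynomial.coeff γ))) r.2 s.2

/-- The matrix-valued measure `∑ᵢ Wᵢ δ_{xᵢ}` on `ℝⁿ`, as the matrix of its entries, which are
signed measures. -/
def atomicMeasure {n m r : ℕ} (x : Fin r → Fin n → ℝ) (W : Fin r → Matrix (Fin m) (Fin m) ℝ) :
    Matrix (Fin m) (Fin m) (SignedMeasure (Fin n → ℝ)) :=
  Matrix.of fun a b => ∑ i, VectorMeasure.dirac (x i) (W i a b)

/-- `Φ` has the moments `S_α = ∫ x^α dΦ(x)` for all `|α| ≤ d`, the integral being entrywise. -/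
def HasMoments {n m : ℕ} (Φ : Matrix (Fin m) (Fin m) (SignedMeasure (Fin n → ℝ)))
    (S : (Fin n →₀ ℕ) → Matrix (Fin m) (Fin m) ℝ) (d : ℕ) : Prop :=
  ∀ α : Fin n →₀ ℕ, α.degree ≤ d → ∀ a b : Fin m,
    (Φ a b).Integrable (mon α) ∧
      S α a b = VectorMeasure.integral (Φ a b) (mon α) (ContinuousLinearMap.lsmul ℝ ℝ)

theorem integrable_dirac_real {n : ℕ} (x : Fin n → ℝ) (c : ℝ) (f : (Fin n → ℝ) → ℝ) :
    (VectorMeasure.dirac x c).Integrable f := by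
  have h : Integrable f (Measure.dirac x) := integrable_dirac (by simp)
  have h' : Integrable f (‖c‖ₑ • Measure.dirac x) := h.smul_measure enorm_ne_top
  rw [← VectorMeasure.variation_dirac] at h'
  exact h'

theorem integrable_atomicMeasure {n m r : ℕ} (x : Fin r → Fin n → ℝ)
    (W : Fin r → Matrix (Fin m) (Fin m) ℝ) (f : (Fin n → ℝ) → ℝ) (a b : Fin m) :
    (atomicMeasure x W a b).Integrable f := by
  have h := VectorMeasure.Integrable.finsetSum_vectorMeasure (s := Finset.univ) (f := f)
    (μ := fun i : Fin r => VectorMeasure.dirac (x i) (W i a b))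
    (fun i _ => integrable_dirac_real (x i) (W i a b) f)
  exact h

theorem integral_atomicMeasure {n m r : ℕ} (x : Fin r → Fin n → ℝ)
    (W : Fin r → Matrix (Fin m) (Fin m) ℝ) (f : (Fin n → ℝ) → ℝ) (a b : Fin m) :
    VectorMeasure.integral (atomicMeasure x W a b) f (ContinuousLinearMap.lsmul ℝ ℝ) =
      (∑ i, f (x i) • W i) a b := by
  have h := VectorMeasure.integral_finsetSum_vectorMeasure (s := Finset.univ) (f := f)
    (B := ContinuousLinearMap.lsmul ℝ ℝ)
    (μ := fun i : Fin r => VectorMeasure.dirac (x i) (W i a b))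
    (fun i _ => integrable_dirac_real (x i) (W i a b) f)
  refine Eq.trans h ?_
  rw [Matrix.sum_apply]
  refine Finset.sum_congr rfl fun i _ => ?_
  rw [VectorMeasure.integral_dirac]
  simp

theorem hasMoments_atomicMeasure_iff {n m r : ℕ} (x : Fin r → Fin n → ℝ)
    (W : Fin r → Matrix (Fin m) (Fin m) ℝ) (S : (Fin n →₀ ℕ) → Matrix (Fin m) (Fin m) ℝ)
    (d : ℕ) :
    HasMoments (atomicMeasure x W) S d ↔
      ∀ α : Fin n →₀ ℕ, α.degree ≤ d → S α = ∑ i, mon α (x i) • W i := by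
  constructor
  · intro h α hα
    ext a b
    rw [(h α hα a b).2, integral_atomicMeasure]
  · intro h α hα a b
    exact ⟨integrable_atomicMeasure x W _ a b, by rw [integral_atomicMeasure, h α hα]⟩

/-- `∑ᵢ Wᵢ δ_{xᵢ}` is a finitely atomic PSD representing measure of the truncated sequence
`(S_α)_{|α| ≤ 2k}`, supported on `{G ⪰ 0}`, with `∑ᵢ rank Wᵢ = rank M_k(S)`.
The atoms `xᵢ` are distinct and carry nonzero weights. -/
structure IsAtomicRep {n m q r : ℕ} (G : Matrix (Fin q) (Fin q) (MvPolynomial (Fin n) ℝ))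
    (S : (Fin n →₀ ℕ) → Matrix (Fin m) (Fin m) ℝ) (k : ℕ)
    (x : Fin r → Fin n → ℝ) (W : Fin r → Matrix (Fin m) (Fin m) ℝ) : Prop where
  distinct : Function.Injective x
  mem : ∀ i, x i ∈ feasibleSet G
  psd : ∀ i, (W i).PosSemidef
  ne_zero : ∀ i, W i ≠ 0
  moments : HasMoments (atomicMeasure x W) S (2 * k)
  rank_eq : ∑ i, (W i).rank = (momentMatrix S k).rank

/-- The order of the monomials in `u_k(x) = (1, x₁, …, xₙ, x₁², x₁x₂, …, xₙᵏ)`: `x^α` comes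
before `x^β`. -/
def MonBefore {n : ℕ} (α β : Fin n →₀ ℕ) : Prop :=
  α.degree < β.degree ∨
    (α.degree = β.degree ∧ ∃ l, (∀ l' < l, α l' = β l') ∧ β l < α l)

/-- The order of the rows of `M_k(S)`, i.e. of the monomials `x^α w_j` in
`v_k(x, w) = (w, x₁ w, …, xₙ w, x₁² w, x₁x₂ w, …, xₙᵏ w)`. -/
def RowBefore {n m k : ℕ} (r s : Expo n k × Fin m) : Prop :=
  MonBefore r.1.1 s.1.1 ∨ (r.1 = s.1 ∧ r.2 < s.2)

/-- `U` is in (reduced) column echelon form with pivot rows `p 0, …, p (t-1)`. -/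
structure IsColumnEchelon {n m k t : ℕ} (U : Matrix (Expo n k × Fin m) (Fin t) ℝ)
    (p : Fin t → Expo n k × Fin m) : Prop where
  pivots_increase : ∀ a b, a < b → RowBefore (p a) (p b)
  pivot_rows : ∀ a b, U (p a) b = if a = b then 1 else 0
  zero_above : ∀ s a, RowBefore s (p a) → U s a = 0

/-- `U` arises from `V` by invertible column operations. -/
def ColumnEquivalent {ι : Type*} {t : ℕ} (V U : Matrix ι (Fin t) ℝ) : Prop :=
  ∃ Q : Matrix (Fin t) (Fin t) ℝ, IsUnit Q ∧ U = V * Q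

/-- The vector `b_k(x, w)`: the monomials `x^α w_j` at the pivot rows `(α, j)`. -/
def basisVec {n m k t : ℕ} (p : Fin t → Expo n k × Fin m) (x : Fin n → ℝ) (w : Fin m → ℝ) :
    Fin t → ℝ :=
  fun a => mon (p a).1.1 x * w (p a).2

/-- The multiplication matrix `N_l` extracted from `U`: if the `a`-th basis monomial is
`x^α w_j`, then the `a`-th row of `N_l` is the row of `U` at the monomial `x_l x^α w_j`.
(If that monomial has degree above `k` in `x`, there is no such row, and `0` is put.) -/
def multMatrix {n m k t : ℕ} (U : Matrix (Expo n k × Fin m) (Fin t) ℝ)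
    (p : Fin t → Expo n k × Fin m) (l : Fin n) : Matrix (Fin t) (Fin t) ℝ :=
  Matrix.of fun a b =>
    if h : ((p a).1.1 + Finsupp.single l 1).degree ≤ k then
      U (⟨(p a).1.1 + Finsupp.single l 1, h⟩, (p a).2) b
    else 0

/-- `N = A T Aᵀ` is an ordered (real) Schur decomposition: `A` is orthogonal, `T` is upper
triangular and its diagonal is sorted increasingly. -/
structure IsOrderedSchur {t : ℕ} (N A T : Matrix (Fin t) (Fin t) ℝ) : Prop where
  orthogonal : A.transpose * A = 1
  eq : N = A * T * A.transpose
  upper : ∀ i j, j < i → T i j = 0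
  sorted : Monotone fun j => T j j

/-- The point `(aᵀ N_1 a, …, aᵀ N_n a)`. -/
def quadPoint {n t : ℕ} (N : Fin n → Matrix (Fin t) (Fin t) ℝ) (a : Fin t → ℝ) : Fin n → ℝ :=
  fun l => a ⬝ᵥ Matrix.mulVec (N l) a

end MatrixMoment

end

/-!
Put `M = M_k(S)` and `t = rank M`.

*Existence.* Write `M` as the Gram matrix of vectors `v_{α,j}` spanning a `t`-dimensional Euclidean
space (`exists_gram_of_posSemidef`). By flatness the vectors with `|α| ≤ k - d_G`, and so those with
`|α| ≤ k - 1`, already span. As `⟪v_{α,i}, v_{β,j}⟫` depends on `α + β` only, the shifts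
`v_{α,j} ↦ v_{α+e_l,j}` are well defined symmetric operators (`exists_isSymmetric_of_inner_eq`), and
they commute. A joint orthonormal eigenbasis `e_s` with joint eigenvalues `y_s` gives
`S_α = ∑_s y_s^α u_s u_sᵀ`, where `u_s` has the entries `⟪v_{0,j}, e_s⟫` (`exists_dyadic_atoms`).
Writing `e_s` as a combination of the `v_{α,j}` with `|α| ≤ k - d_G` and testing the localizing
matrix against the coefficients yields `G(y_s) ⪰ 0` (`mem_feasibleSet_of_localizing`). Merging equal
points gives the measure; its rank sum is at most the number `t` of dyads, and at least `rank M`.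

*Multiplication matrices.* For any minimal representing measure, dyadic decompositions of the
weights give `M = Z Zᵀ`, where `Z` has the `t` columns `v_k(x⁽ⁱ⁾, w⁽ⁱʲ⁾)`. Since also `M = V Vᵀ`, the
columns of `Z` and of `U` span the range of `M`, and comparing pivot rows shows that `U` maps
`b_k(x⁽ⁱ⁾, w⁽ⁱʲ⁾)` to the column `(i, j)` of `Z` (`mulVec_basisVec`). Reading this at the rows
`x_l x^α w_j` gives the eigenvector relations; independence is that of the columns of `Z`.

*Schur decompositions.* The `N_l` have a common eigenbasis, and `N = ∑ c_l N_l` separates the points.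
Orthogonalizing the sorted eigenbasis gives an ordered Schur decomposition (`exists_orderedSchur`).
Conversely, by interpolation `N_l = P_l(N)` for a polynomial `P_l`, so `Aᵀ N_l A = P_l(T)` is upper
triangular with diagonal `P_l(T_jj)`. The sorted diagonal of `T` lists the eigenvalues of `N`, and
`P_l` sends each of them to the coordinate `x_l` of its atom (`quadPoint_col_eq`).
-/

noncomputable section

namespace MatrixMoment

/-! ### Gram matrices -/

theorem rank_eq_finrank_span_of_gram {ι E : Type*} [Fintype ι]
    [NormedAddCommGroup E] [InnerProductSpace ℝ E] {M : Matrix ι ι ℝ} {v : ι → E}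
    (h : ∀ r s, M r s = inner ℝ (v r) (v s)) :
    M.rank = Module.finrank ℝ (Submodule.span ℝ (Set.range v)) := by
  have hker : LinearMap.ker M.mulVecLin = LinearMap.ker (Fintype.linearCombination ℝ v) := by
    have key : ∀ (c : ι → ℝ) r, M.mulVec c r = inner ℝ (v r) (∑ s, c s • v s) := by
      intro c r
      simp [Matrix.mulVec, dotProduct, inner_sum, inner_smul_right, h, mul_comm]
    ext c
    simp only [LinearMap.mem_ker, Matrix.mulVecLin_apply, Fintype.linearCombination_apply]
    constructor
    · intro hc
      rw [← inner_self_eq_zero (𝕜 := ℝ), sum_inner]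
      refine Finset.sum_eq_zero fun r _ => ?_
      rw [inner_smul_left, ← key, hc]
      simp
    · intro hc
      ext r
      rw [key, hc]
      simp
  have h1 := LinearMap.finrank_range_add_finrank_ker M.mulVecLin
  have h2 := LinearMap.finrank_range_add_finrank_ker (Fintype.linearCombination ℝ v)
  rw [Fintype.range_linearCombination] at h2
  rw [hker] at h1
  have : M.rank = Module.finrank ℝ (LinearMap.range M.mulVecLin) := rfl
  omega

open scoped ComplexOrder MatrixOrder in
/-- A positive semidefinite matrix is the Gram matrix of a family that spans a Euclidean space
whose dimension is the rank of the matrix. -/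
theorem exists_gram_of_posSemidef {ι : Type*} [Fintype ι] [DecidableEq ι] {M : Matrix ι ι ℝ}
    (hM : M.PosSemidef) :
    ∃ v : ι → EuclideanSpace ℝ (Fin M.rank), (∀ r s, M r s = inner ℝ (v r) (v s)) ∧
      Submodule.span ℝ (Set.range v) = ⊤ := by
  obtain ⟨B, hB⟩ := CStarAlgebra.nonneg_iff_eq_star_mul_self.mp hM.nonneg
  let b : ι → EuclideanSpace ℝ ι := fun r => WithLp.toLp 2 (B.col r)
  have hb : ∀ r s, M r s = inner ℝ (b r) (b s) := by
    intro r s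
    rw [hB]
    simp [b, Matrix.mul_apply, PiLp.inner_apply, Matrix.star_apply, mul_comm]
  let F := Submodule.span ℝ (Set.range b)
  have hF : Module.finrank ℝ F = M.rank := (rank_eq_finrank_span_of_gram hb).symm
  let e := (stdOrthonormalBasis ℝ F).reindex (finCongr hF)
  let b' : ι → F := fun r => ⟨b r, Submodule.subset_span ⟨r, rfl⟩⟩
  have hspan : Submodule.span ℝ (Set.range b') = ⊤ := by
    have : Set.range b' = (Subtype.val : F → _) ⁻¹' Set.range b := by
      ext ⟨y, hy⟩
      simp [b']
    rw [this]
    exact Submodule.span_span_coe_preimage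
  refine ⟨fun r => e.repr (b' r), fun r s => ?_, ?_⟩
  · rw [LinearIsometryEquiv.inner_map_map, hb]
    rfl
  · have : (Set.range fun r => e.repr (b' r)) =
        (e.repr.toLinearEquiv : F →ₗ[ℝ] _) '' Set.range b' := by
      rw [← Set.range_comp]; rfl
    rw [this, Submodule.span_image, hspan, Submodule.map_top]
    exact LinearEquiv.range _

/-- A positive semidefinite matrix is a sum of as many dyads as its rank. -/
theorem exists_sum_vecMulVec_of_posSemidef {ι : Type*} [Fintype ι] [DecidableEq ι]
    {M : Matrix ι ι ℝ} (hM : M.PosSemidef) :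
    ∃ w : Fin M.rank → ι → ℝ, M = ∑ j, Matrix.vecMulVec (w j) (w j) := by
  obtain ⟨v, hv, -⟩ := exists_gram_of_posSemidef hM
  refine ⟨fun j a => v a j, ?_⟩
  ext a b
  rw [hv, Matrix.sum_apply]
  simp [PiLp.inner_apply, Matrix.vecMulVec_apply, mul_comm]

/-! ### Symmetric operators -/

/-- If `v` spans and `⟪v' i, v j⟫ = ⟪v i, v' j⟫`, then `v i ↦ v' i` extends to a symmetric linear
map: the relation forces every linear relation among the `v i` to hold among the `v' i`. -/
theorem exists_isSymmetric_of_inner_eq {ι E : Type*} [Fintype ι]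
    [NormedAddCommGroup E] [InnerProductSpace ℝ E] {v v' : ι → E}
    (hv : Submodule.span ℝ (Set.range v) = ⊤)
    (h : ∀ i j, inner ℝ (v' i) (v j) = inner ℝ (v i) (v' j)) :
    ∃ X : E →ₗ[ℝ] E, X.IsSymmetric ∧ ∀ i, X (v i) = v' i := by
  classical
  set L := Fintype.linearCombination ℝ v
  set L' := Fintype.linearCombination ℝ v'
  have hL : LinearMap.range L = ⊤ := by rw [Fintype.range_linearCombination, hv]
  have hinner : ∀ a b, inner ℝ (L' a) (L b) = inner ℝ (L a) (L' b) := by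
    intro a b
    simp [L, L', Fintype.linearCombination_apply, sum_inner, inner_sum, inner_smul_left,
      inner_smul_right, h]
  obtain ⟨g, hg⟩ := L.exists_rightInverse_of_surjective hL
  have hLg : ∀ y, L (g y) = y := fun y => LinearMap.congr_fun hg y
  have hker : ∀ c, L c = 0 → L' c = 0 := by
    intro c hc
    have h0 := hinner c (g (L' c))
    rwa [hLg, hc, inner_zero_left, inner_self_eq_zero] at h0
  refine ⟨L' ∘ₗ g, fun x y => ?_, fun i => ?_⟩
  · have h0 := hinner (g x) (g y)
    rwa [hLg, hLg] at h0
  · have h1 : L (g (v i) - Pi.single i 1) = 0 := by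
      rw [map_sub, hLg]
      simp [L, Fintype.linearCombination_apply_single]
    have h2 := hker _ h1
    rw [map_sub, sub_eq_zero] at h2
    rw [LinearMap.comp_apply, h2]
    simp [L', Fintype.linearCombination_apply_single]

theorem eq_of_forall_inner_eq_of_span {ι E : Type*}
    [NormedAddCommGroup E] [InnerProductSpace ℝ E] {v : ι → E}
    (hv : Submodule.span ℝ (Set.range v) = ⊤) {x y : E}
    (h : ∀ i, inner ℝ x (v i) = inner ℝ y (v i)) : x = y := by
  refine ext_inner_right ℝ fun z => ?_
  have hz : z ∈ Submodule.span ℝ (Set.range v) := hv ▸ Submodule.mem_top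
  induction hz using Submodule.span_induction with
  | mem z hz => obtain ⟨i, rfl⟩ := hz; exact h i
  | zero => simp
  | add a b _ _ ha hb => rw [inner_add_right, ha, hb, inner_add_right]
  | smul r a _ ha => rw [inner_smul_right, ha, inner_smul_right]

open scoped Function in
/-- Commuting symmetric operators have a common orthonormal eigenbasis. -/
theorem exists_joint_eigenbasis {n t : ℕ} {E : Type*} [NormedAddCommGroup E]
    [InnerProductSpace ℝ E] [FiniteDimensional ℝ E] (ht : Module.finrank ℝ E = t)
    {X : Fin n → E →ₗ[ℝ] E} (hX : ∀ l, (X l).IsSymmetric)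
    (hc : Pairwise (Commute on X)) :
    ∃ (e : OrthonormalBasis (Fin t) ℝ E) (y : Fin t → Fin n → ℝ),
      ∀ s l, X l (e s) = y s l • e s := by
  classical
  let A : (Fin n → ℝ) → Submodule ℝ E := fun α => ⨅ j, Module.End.eigenspace (X j) (α j)
  have hA : DirectSum.IsInternal A :=
    LinearMap.IsSymmetric.directSum_isInternal_of_pairwise_commute hX hc
  have hO : OrthogonalFamily ℝ (fun α => A α) fun α => (A α).subtypeₗᵢ :=
    LinearMap.IsSymmetric.orthogonalFamily_iInf_eigenspaces hX
  -- Only finitely many joint eigenspaces are nonzero.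
  have hfin : {α | A α ≠ ⊥}.Finite :=
    WellFoundedGT.finite_ne_bot_of_iSupIndep hA.submodule_iSupIndep
  have : Fintype {α // A α ≠ ⊥} := hfin.fintype
  have hA' : DirectSum.IsInternal fun α : {α // A α ≠ ⊥} => A α :=
    DirectSum.isInternal_ne_bot_iff.mpr hA
  have hO' := hO.comp (Subtype.val_injective (p := fun α => A α ≠ ⊥))
  refine ⟨hA'.subordinateOrthonormalBasis ht hO',
    fun s => (hA'.subordinateOrthonormalBasisIndex ht s hO').1, fun s l => ?_⟩
  have h := hA'.subordinateOrthonormalBasis_subordinate ht s hO'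
  exact Module.End.mem_eigenspace_iff.mp ((Submodule.mem_iInf _).mp h l)

/-! ### Upper triangular matrices and Schur decompositions -/

theorem diag_mul_of_upper {t : ℕ} {P Q : Matrix (Fin t) (Fin t) ℝ}
    (hP : P.IsUpperTriangular) (hQ : Q.IsUpperTriangular) (j : Fin t) :
    (P * Q) j j = P j j * Q j j := by
  rw [Matrix.mul_apply]
  refine Finset.sum_eq_single j (fun b _ hb => ?_) (by simp)
  rcases lt_or_gt_of_ne hb with h | h
  · rw [hP h, zero_mul]
  · rw [hQ h, mul_zero]

theorem aeval_upper {t : ℕ} {T : Matrix (Fin t) (Fin t) ℝ} (hT : T.IsUpperTriangular)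
    (P : Polynomial ℝ) :
    (Polynomial.aeval T P).IsUpperTriangular ∧
      ∀ j, (Polynomial.aeval T P) j j = P.eval (T j j) := by
  induction P using Polynomial.induction_on' with
  | add p q hp hq =>
    refine ⟨?_, fun j => ?_⟩
    · rw [map_add]; exact hp.1.add hq.1
    · rw [map_add, Matrix.add_apply, hp.2, hq.2, Polynomial.eval_add]
  | monomial m a =>
    have hpow : (T ^ m).IsUpperTriangular ∧ ∀ j, (T ^ m) j j = T j j ^ m := by
      induction m with
      | zero => exact ⟨by rw [pow_zero]; exact Matrix.blockTriangular_one, by simp⟩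
      | succ m ih =>
        refine ⟨by rw [pow_succ]; exact ih.1.mul hT, fun j => ?_⟩
        rw [pow_succ, diag_mul_of_upper ih.1 hT, ih.2, pow_succ]
    rw [Polynomial.aeval_monomial, ← Algebra.smul_def]
    refine ⟨fun i j hij => ?_, fun j => ?_⟩
    · rw [Matrix.smul_apply, hpow.1 hij, smul_zero]
    · rw [Matrix.smul_apply, hpow.2, Polynomial.eval_monomial, smul_eq_mul]

theorem aeval_mul_eq_mul_aeval {ι : Type*} [Fintype ι] [DecidableEq ι] {N A T : Matrix ι ι ℝ}
    (h : N * A = A * T) (P : Polynomial ℝ) :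
    Polynomial.aeval N P * A = A * Polynomial.aeval T P := by
  induction P using Polynomial.induction_on' with
  | add p q hp hq => rw [map_add, map_add, add_mul, mul_add, hp, hq]
  | monomial m a =>
    have hpow : N ^ m * A = A * T ^ m := by
      have : SemiconjBy A T N := h.symm
      exact (this.pow_right m).symm
    rw [Polynomial.aeval_monomial, Polynomial.aeval_monomial, ← Algebra.smul_def,
      ← Algebra.smul_def, smul_mul_assoc, hpow, mul_smul_comm]

theorem aeval_diagonal_apply {t : ℕ} (d : Fin t → ℝ) (P : Polynomial ℝ) :
    Polynomial.aeval (Matrix.diagonal d) P = Matrix.diagonal fun j => P.eval (d j) := by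
  induction P using Polynomial.induction_on' with
  | add p q hp hq => rw [map_add, hp, hq, Matrix.diagonal_add]; simp
  | monomial m a =>
    rw [Polynomial.aeval_monomial, ← Algebra.smul_def, Matrix.diagonal_pow, ← Matrix.diagonal_smul]
    congr 1
    ext j
    simp

/-- The `QR` decomposition of a real square matrix. -/
theorem exists_orthogonal_mul_upper {t : ℕ} (B : Matrix (Fin t) (Fin t) ℝ) :
    ∃ A R : Matrix (Fin t) (Fin t) ℝ, A.transpose * A = 1 ∧ R.IsUpperTriangular ∧ B = A * R := by
  let f : Fin t → EuclideanSpace ℝ (Fin t) := fun j => WithLp.toLp 2 (B.col j)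
  let e := InnerProductSpace.gramSchmidtOrthonormalBasis (𝕜 := ℝ) (by simp) f
  refine ⟨Matrix.of fun i j => e j i, e.toBasis.toMatrix f,
    ?_, InnerProductSpace.gramSchmidtOrthonormalBasis_inv_isUpperTriangular _ f, ?_⟩
  · ext i j
    have := orthonormal_iff_ite.mp e.orthonormal i j
    rw [Matrix.one_apply, ← this]
    simp [Matrix.mul_apply, PiLp.inner_apply, mul_comm]
  · ext i j
    have h := congrArg (fun z : EuclideanSpace ℝ (Fin t) => z i) (e.sum_repr (f j))
    simp only [WithLp.ofLp_sum, Finset.sum_apply, WithLp.ofLp_smul, Pi.smul_apply] at h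
    have h2 : f j i = B i j := rfl
    rw [← h2, ← h, Matrix.mul_apply]
    simp [Module.Basis.toMatrix_apply, mul_comm]

/-- A matrix with a real eigenbasis, the eigenvalues being sorted, has an ordered Schur
decomposition: orthogonalize the eigenbasis. -/
theorem exists_orderedSchur {t : ℕ} {N B : Matrix (Fin t) (Fin t) ℝ} {d : Fin t → ℝ}
    (hB : IsUnit B) (hd : Monotone d) (h : N * B = B * Matrix.diagonal d) :
    ∃ A T, IsOrderedSchur N A T := by
  obtain ⟨A, R, hA, hR, rfl⟩ := exists_orthogonal_mul_upper B
  have hA' : A * A.transpose = 1 := mul_eq_one_comm.mp hA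
  have hRu : IsUnit R := isUnit_of_mul_isUnit_right hB
  have : Invertible R := hRu.invertible
  have hRi : (R⁻¹).IsUpperTriangular := Matrix.blockTriangular_inv_of_blockTriangular hR
  have hRR : R * R⁻¹ = 1 := Matrix.mul_inv_of_invertible R
  have hD : (Matrix.diagonal d).IsUpperTriangular := Matrix.blockTriangular_diagonal d
  have hup : (R * Matrix.diagonal d * R⁻¹).IsUpperTriangular := (hR.mul hD).mul hRi
  have hdiag : ∀ j, (R * Matrix.diagonal d * R⁻¹) j j = d j := by
    intro j
    have h1 := congrFun (congrFun hRR j) j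
    rw [diag_mul_of_upper hR hRi, Matrix.one_apply_eq] at h1
    rw [diag_mul_of_upper (hR.mul hD) hRi, diag_mul_of_upper hR hD, Matrix.diagonal_apply_eq]
    linear_combination d j * h1
  refine ⟨A, R * Matrix.diagonal d * R⁻¹, hA, ?_, fun i j hij => hup hij, fun i j hij => ?_⟩
  · calc N = N * (A * (R * R⁻¹) * A.transpose) := by rw [hRR, mul_one, hA', mul_one]
      _ = (N * (A * R)) * R⁻¹ * A.transpose := by simp only [mul_assoc]
      _ = _ := by rw [h]; simp only [mul_assoc]
  · simp only [hdiag]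
    exact hd hij

theorem charpoly_eq_of_mul_eq_mul {t : ℕ} {N B D : Matrix (Fin t) (Fin t) ℝ}
    (hB : IsUnit B) (h : N * B = B * D) : N.charpoly = D.charpoly := by
  obtain ⟨u, rfl⟩ := hB
  rw [← Matrix.charpoly_units_conj u D, ← h]
  simp

/-- Upper triangular matrices similar to a diagonal matrix have the same diagonal up to order. -/
theorem map_diag_eq {t : ℕ} {N A B T : Matrix (Fin t) (Fin t) ℝ} {d : Fin t → ℝ}
    (hA : IsUnit A) (hT : T.IsUpperTriangular) (hNA : N * A = A * T)
    (hB : IsUnit B) (hNB : N * B = B * Matrix.diagonal d) :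
    Finset.univ.val.map (fun j => T j j) = Finset.univ.val.map d := by
  have h := (charpoly_eq_of_mul_eq_mul hA hNA).symm.trans (charpoly_eq_of_mul_eq_mul hB hNB)
  rw [Matrix.charpoly_of_isUpperTriangular _ hT,
    Matrix.charpoly_of_isUpperTriangular _ (Matrix.blockTriangular_diagonal d)] at h
  have h' := congrArg Polynomial.roots h
  have key : ∀ g : Fin t → ℝ,
      (∏ i, (Polynomial.X - Polynomial.C (g i))).roots = Finset.univ.val.map g := fun g => by
    rw [Polynomial.roots_prod _ _ (Finset.prod_ne_zero_iff.mpr fun i _ =>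
      Polynomial.X_sub_C_ne_zero _)]
    simp [Multiset.bind_singleton]
  simpa [key, Matrix.diagonal_apply_eq] using h'

/-! ### Monomials and sums of dyads -/

theorem mon_add {n : ℕ} (α β : Fin n →₀ ℕ) (x : Fin n → ℝ) :
    mon (α + β) x = mon α x * mon β x := by
  simp [mon, pow_add, Finset.prod_mul_distrib]

theorem mon_zero {n : ℕ} (x : Fin n → ℝ) : mon 0 x = 1 := by simp [mon]

theorem mon_single {n : ℕ} (l : Fin n) (x : Fin n → ℝ) : mon (Finsupp.single l 1) x = x l := by
  unfold mon
  rw [Finset.prod_eq_single l]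
  · simp
  · intro b _ hb
    simp [hb.symm]
  · simp

/-- The matrix whose column `s` is `v_k(x_s, w_s)`. -/
def atomMatrix {n m : ℕ} {I : Type*} (k : ℕ) (x : I → Fin n → ℝ) (w : I → Fin m → ℝ) :
    Matrix (Expo n k × Fin m) I ℝ :=
  Matrix.of fun r s => mon r.1.1 (x s) * w s r.2

theorem momentMatrix_eq_atomMatrix {n m : ℕ} {I : Type*} [Fintype I] {k : ℕ}
    {S : (Fin n →₀ ℕ) → Matrix (Fin m) (Fin m) ℝ} {x : I → Fin n → ℝ} {w : I → Fin m → ℝ}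
    (h : ∀ α : Fin n →₀ ℕ, α.degree ≤ 2 * k →
      S α = ∑ s, mon α (x s) • Matrix.vecMulVec (w s) (w s)) :
    momentMatrix S k = atomMatrix k x w * (atomMatrix k x w).transpose := by
  ext ⟨⟨α, hα⟩, a⟩ ⟨⟨β, hβ⟩, b⟩
  have hαβ : (α + β).degree ≤ 2 * k := by rw [map_add]; omega
  simp only [momentMatrix, Matrix.of_apply, h _ hαβ, Matrix.sum_apply, Matrix.mul_apply,
    atomMatrix, Matrix.transpose_apply, Matrix.smul_apply, Matrix.vecMulVec_apply, smul_eq_mul,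
    mon_add]
  exact Finset.sum_congr rfl fun s _ => by ring

theorem rank_sum_vecMulVec_le {ι I : Type*} [Fintype ι] (J : Finset I) (w : I → ι → ℝ) :
    (∑ s ∈ J, Matrix.vecMulVec (w s) (w s)).rank ≤ J.card := by
  have : ∑ s ∈ J, Matrix.vecMulVec (w s) (w s) =
      (Matrix.of fun a (s : J) => w s a) * (Matrix.of fun (s : J) a => w s a) := by
    ext a b
    rw [Matrix.sum_apply, Matrix.mul_apply, ← Finset.sum_coe_sort]
    rfl
  rw [this]
  refine (Matrix.rank_mul_le_left _ _).trans ((Matrix.rank_le_card_width _).trans ?_)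
  simp

/-- Dyadic decompositions of the weights turn an atomic representation with matrix weights into
one with rank-one weights. -/
theorem sum_sigma_dyads {n m r : ℕ} {x : Fin r → Fin n → ℝ}
    {W : Fin r → Matrix (Fin m) (Fin m) ℝ} {w : (i : Fin r) → Fin (W i).rank → Fin m → ℝ}
    (hw : ∀ i, W i = ∑ j, Matrix.vecMulVec (w i j) (w i j)) (α : Fin n →₀ ℕ) :
    ∑ i, mon α (x i) • W i = ∑ ij : (i : Fin r) × Fin (W i).rank,
      mon α (x ij.1) • Matrix.vecMulVec (w ij.1 ij.2) (w ij.1 ij.2) := by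
  rw [Fintype.sum_sigma]
  refine Finset.sum_congr rfl fun i _ => ?_
  conv_lhs => rw [hw i]
  rw [Finset.smul_sum]

theorem momentMatrix_rank_le {n m r k : ℕ} {S : (Fin n →₀ ℕ) → Matrix (Fin m) (Fin m) ℝ}
    {x : Fin r → Fin n → ℝ} {W : Fin r → Matrix (Fin m) (Fin m) ℝ}
    (hW : ∀ i, (W i).PosSemidef)
    (h : ∀ α : Fin n →₀ ℕ, α.degree ≤ 2 * k → S α = ∑ i, mon α (x i) • W i) :
    (momentMatrix S k).rank ≤ ∑ i, (W i).rank := by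
  choose w hw using fun i => exists_sum_vecMulVec_of_posSemidef (hW i)
  rw [momentMatrix_eq_atomMatrix (x := fun ij : (i : Fin r) × Fin (W i).rank => x ij.1)
    (w := fun ij => w ij.1 ij.2) fun α hα => by rw [h α hα, sum_sigma_dyads hw]]
  refine (Matrix.rank_mul_le_left _ _).trans ((Matrix.rank_le_card_width _).trans ?_)
  simp

/-! ### Rank-one atoms from a flat moment matrix -/

/-- A flat moment matrix is represented by rank-one atoms. The shifts `x^α w_j ↦ x_l x^α w_j`
induce commuting symmetric operators on the Gram space of the moment matrix; the atoms are their
joint eigenvalues. The second assertion supplies, for each atom, a polynomial vector of degree at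
most `k - d` that detects it alone. -/
theorem exists_dyadic_atoms {n m k d : ℕ} {S : (Fin n →₀ ℕ) → Matrix (Fin m) (Fin m) ℝ}
    (hd : 1 ≤ d) (hdk : d ≤ k) (hM : (momentMatrix S k).PosSemidef)
    (hflat : (momentMatrix S k).rank = (momentMatrix S (k - d)).rank) :
    ∃ (y : Fin (momentMatrix S k).rank → Fin n → ℝ)
      (u : Fin (momentMatrix S k).rank → Fin m → ℝ),
      (∀ α : Fin n →₀ ℕ, α.degree ≤ 2 * k →
        S α = ∑ s, mon α (y s) • Matrix.vecMulVec (u s) (u s)) ∧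
      ∀ s, ∃ c : Expo n (k - d) × Fin m → ℝ,
        ∀ s', ∑ r, c r * atomMatrix (k - d) y u r s' = if s = s' then 1 else 0 := by
  classical
  obtain ⟨E, _, _, _, hE, v, hv⟩ : ∃ (E : Type) (_ : NormedAddCommGroup E)
      (_ : InnerProductSpace ℝ E) (_ : FiniteDimensional ℝ E),
      Module.finrank ℝ E = (momentMatrix S k).rank ∧
        ∃ v : Expo n k × Fin m → E, ∀ r s, momentMatrix S k r s = inner ℝ (v r) (v s) := by
    obtain ⟨v, hv, -⟩ := exists_gram_of_posSemidef hM
    exact ⟨_, inferInstance, inferInstance, inferInstance, by simp, v, hv⟩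
  -- The Gram vector of `x^α w_a`, extended by zero to all exponents.
  let vv : (Fin n →₀ ℕ) → Fin m → E := fun α a =>
    if h : α.degree ≤ k then v (⟨α, h⟩, a) else 0
  have hvv : ∀ α β : Fin n →₀ ℕ, α.degree ≤ k → β.degree ≤ k → ∀ a b,
      inner ℝ (vv α a) (vv β b) = S (α + β) a b := by
    intro α β hα hβ a b
    simp only [vv, hα, hβ, dif_pos]
    rw [← hv]
    rfl
  -- Flatness: the vectors of degree at most `k - d` already span.
  have hspan : Submodule.span ℝ
      (Set.range fun r : Expo n (k - d) × Fin m => vv r.1.1 r.2) = ⊤ := by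
    have h1 : (momentMatrix S (k - d)).rank = Module.finrank ℝ (Submodule.span ℝ
        (Set.range fun r : Expo n (k - d) × Fin m => vv r.1.1 r.2)) := by
      refine rank_eq_finrank_span_of_gram fun r s => ?_
      have hr := r.1.2
      have hs := s.1.2
      rw [hvv _ _ (by omega) (by omega)]
      rfl
    refine Submodule.eq_top_of_finrank_eq ?_
    rw [← h1, ← hflat, hE]
  have hspan1 : Submodule.span ℝ
      (Set.range fun r : Expo n (k - 1) × Fin m => vv r.1.1 r.2) = ⊤ := by
    rw [eq_top_iff, ← hspan]
    refine Submodule.span_mono ?_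
    rintro _ ⟨r, rfl⟩
    have hr := r.1.2
    exact ⟨(⟨r.1.1, by omega⟩, r.2), rfl⟩
  -- The shift operators.
  have hshift : ∀ l : Fin n, ∃ X : E →ₗ[ℝ] E, X.IsSymmetric ∧ ∀ r : Expo n (k - 1) × Fin m,
      X (vv r.1.1 r.2) = vv (r.1.1 + Finsupp.single l 1) r.2 := by
    intro l
    refine exists_isSymmetric_of_inner_eq hspan1 fun r s => ?_
    have hr := r.1.2
    have hs := s.1.2
    rw [hvv _ _ (by rw [map_add, Finsupp.degree_single]; omega) (by omega),
      hvv _ _ (by omega) (by rw [map_add, Finsupp.degree_single]; omega)]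
    congr 1
    abel_nf
  choose X hsymm hX' using hshift
  have hX : ∀ l (α : Fin n →₀ ℕ) a, α.degree + 1 ≤ k →
      X l (vv α a) = vv (α + Finsupp.single l 1) a := fun l α a hα =>
    hX' l (⟨α, by omega⟩, a)
  have hdeg : ∀ (r : Expo n (k - 1) × Fin m), r.1.1.degree + 1 ≤ k := fun r => by
    have := r.1.2
    omega
  have hcomm : ∀ l l', Commute (X l) (X l') := by
    intro l l'
    have key : ∀ l l' (r s : Expo n (k - 1) × Fin m),
        inner ℝ (X l (X l' (vv r.1.1 r.2))) (vv s.1.1 s.2) =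
          S (r.1.1 + s.1.1 + (Finsupp.single l 1 + Finsupp.single l' 1)) r.2 s.2 := by
      intro l l' r s
      have hr := hdeg r
      have hs := hdeg s
      rw [hsymm l, hX _ _ _ hr, hX _ _ _ hs,
        hvv _ _ (by rw [map_add, Finsupp.degree_single]; omega)
          (by rw [map_add, Finsupp.degree_single]; omega)]
      congr 1
      abel_nf
    refine LinearMap.ext_on_range hspan1 fun r => ?_
    refine eq_of_forall_inner_eq_of_span hspan1 fun s => ?_
    simp only [Module.End.mul_apply]
    rw [key, key, add_comm (Finsupp.single l 1)]
  obtain ⟨e, y, hey⟩ := exists_joint_eigenbasis hE hsymm (fun l l' _ => hcomm l l')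
  have hmon : ∀ (N : ℕ) (α : Fin n →₀ ℕ), α.degree = N → N ≤ k → ∀ a s,
      inner ℝ (vv α a) (e s) = mon α (y s) * inner ℝ (vv 0 a) (e s) := by
    intro N
    induction N with
    | zero =>
      intro α hα _ a s
      rw [Finsupp.degree_eq_zero_iff] at hα
      rw [hα, mon_zero, one_mul]
    | succ N ih =>
      intro α hα hN a s
      obtain ⟨β, hβ, hβd⟩ := α.exists_le_degree_eq N (by omega)
      obtain ⟨γ, rfl⟩ := exists_add_of_le hβ
      have hγ : γ.degree = 1 := by rw [map_add] at hα; omega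
      obtain ⟨l, rfl⟩ : ∃ l, γ = Finsupp.single l 1 :=
        (Finsupp.sum_eq_one_iff γ).mp (by rw [← hγ]; rfl)
      rw [← hX l β a (by omega), hsymm, hey, inner_smul_right, ih β hβd (by omega), mon_add,
        mon_single]
      ring
  refine ⟨y, fun s a => inner ℝ (vv 0 a) (e s), fun α hα => ?_, fun s => ?_⟩
  · obtain ⟨β, hβ, hβd⟩ := α.exists_le_degree_eq (min k α.degree) (min_le_right _ _)
    obtain ⟨γ, rfl⟩ := exists_add_of_le hβ
    have hβk : β.degree ≤ k := hβd ▸ min_le_left _ _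
    have hγk : γ.degree ≤ k := by
      rw [map_add] at hα hβd
      omega
    ext a b
    rw [← hvv β γ hβk hγk, ← e.sum_inner_mul_inner, Matrix.sum_apply]
    refine Finset.sum_congr rfl fun s _ => ?_
    rw [real_inner_comm (vv γ b), hmon _ β rfl hβk, hmon _ γ rfl hγk, Matrix.smul_apply,
      Matrix.vecMulVec_apply, mon_add, smul_eq_mul]
    ring
  · have hs : e s ∈ Submodule.span ℝ
      (Set.range fun r : Expo n (k - d) × Fin m => vv r.1.1 r.2) := hspan ▸ Submodule.mem_top
    obtain ⟨c, hc⟩ := (Submodule.mem_span_range_iff_exists_fun ℝ).mp hs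
    refine ⟨c, fun s' => ?_⟩
    rw [← orthonormal_iff_ite.mp e.orthonormal s s', ← hc, sum_inner]
    refine Finset.sum_congr rfl fun r _ => ?_
    have hr := r.1.2
    rw [inner_smul_left, hmon _ r.1.1 rfl (by omega)]
    rfl

/-! ### The atoms lie in the feasible set -/

theorem degree_le_of_mem_matSupport {n q : ℕ} {G : Matrix (Fin q) (Fin q) (MvPolynomial (Fin n) ℝ)}
    {γ : Fin n →₀ ℕ} (h : γ ∈ matSupport G) : γ.degree ≤ 2 * halfDegree G := by
  simp only [matSupport, Finset.mem_biUnion, Finset.mem_univ, true_and] at h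
  obtain ⟨ab, hab⟩ := h
  have h1 : γ.degree ≤ (G ab.1 ab.2).totalDegree := MvPolynomial.le_totalDegree hab
  have h2 : (G ab.1 ab.2).totalDegree ≤ matDegree G :=
    Finset.le_sup (f := fun ab : Fin q × Fin q => (G ab.1 ab.2).totalDegree) (Finset.mem_univ ab)
  unfold halfDegree
  omega

theorem eval_eq_sum_matSupport {n q : ℕ} (G : Matrix (Fin q) (Fin q) (MvPolynomial (Fin n) ℝ))
    (x : Fin n → ℝ) (i j : Fin q) :
    MvPolynomial.eval x (G i j) = ∑ γ ∈ matSupport G, (G i j).coeff γ * mon γ x := by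
  rw [MvPolynomial.eval_eq']
  refine Finset.sum_subset (fun γ hγ => ?_) fun γ _ hγ => ?_
  · exact Finset.mem_biUnion.mpr ⟨(i, j), Finset.mem_univ _, hγ⟩
  · rw [MvPolynomial.notMem_support_iff.mp hγ, zero_mul]

theorem localizingMatrix_eq_sum {n m q k t : ℕ}
    {G : Matrix (Fin q) (Fin q) (MvPolynomial (Fin n) ℝ)} (hk : halfDegree G ≤ k)
    {S : (Fin n →₀ ℕ) → Matrix (Fin m) (Fin m) ℝ} {y : Fin t → Fin n → ℝ} {u : Fin t → Fin m → ℝ}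
    (h : ∀ α : Fin n →₀ ℕ, α.degree ≤ 2 * k →
      S α = ∑ s, mon α (y s) • Matrix.vecMulVec (u s) (u s))
    (r s : Expo n (k - halfDegree G) × (Fin m × Fin q)) :
    localizingMatrix G S (k - halfDegree G) r s =
      ∑ z, atomMatrix (k - halfDegree G) y u (r.1, r.2.1) z *
        atomMatrix (k - halfDegree G) y u (s.1, s.2.1) z *
          MvPolynomial.eval (y z) (G r.2.2 s.2.2) := by
  simp only [localizingMatrix, Matrix.of_apply, Matrix.sum_apply, eval_eq_sum_matSupport,
    Finset.mul_sum]
  rw [Finset.sum_comm]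
  refine Finset.sum_congr rfl fun γ hγ => ?_
  have hγ' := degree_le_of_mem_matSupport hγ
  have hr := r.1.2
  have hs := s.1.2
  have hdeg : (r.1.1 + s.1.1 + γ).degree ≤ 2 * k := by
    rw [map_add, map_add]; omega
  change S (r.1.1 + s.1.1 + γ) r.2.1 s.2.1 * (G r.2.2 s.2.2).coeff γ = _
  rw [h _ hdeg, Matrix.sum_apply, Finset.sum_mul]
  refine Finset.sum_congr rfl fun z _ => ?_
  simp only [atomMatrix, Matrix.of_apply, Matrix.smul_apply, Matrix.vecMulVec_apply, smul_eq_mul,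
    mon_add]
  ring

theorem sum_prod_mul {I J : Type*} [Fintype I] [Fintype J] (a : I → ℝ) (b : J → ℝ) :
    ∑ p : I × J, a p.1 * b p.2 = (∑ i, a i) * ∑ j, b j := by
  rw [Fintype.sum_mul_sum, Fintype.sum_prod_type]

/-- Testing the localizing matrix against `c ⊗ ξ`, where the polynomial vector with coefficients
`c` detects the atom `s` alone, evaluates the quadratic form of `G(y_s)` at `ξ`. -/
theorem mem_feasibleSet_of_localizing {n m q k t : ℕ}
    {G : Matrix (Fin q) (Fin q) (MvPolynomial (Fin n) ℝ)} (hG : G.IsSymm) (hk : halfDegree G ≤ k)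
    {S : (Fin n →₀ ℕ) → Matrix (Fin m) (Fin m) ℝ} {y : Fin t → Fin n → ℝ} {u : Fin t → Fin m → ℝ}
    (h : ∀ α : Fin n →₀ ℕ, α.degree ≤ 2 * k →
      S α = ∑ s, mon α (y s) • Matrix.vecMulVec (u s) (u s))
    (hL : (localizingMatrix G S (k - halfDegree G)).PosSemidef) {s : Fin t}
    {c : Expo n (k - halfDegree G) × Fin m → ℝ}
    (hc : ∀ s', ∑ r, c r * atomMatrix (k - halfDegree G) y u r s' = if s = s' then 1 else 0) :
    y s ∈ feasibleSet G := by
  set Z := atomMatrix (k - halfDegree G) y u with hZ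
  refine Matrix.PosSemidef.of_dotProduct_mulVec_nonneg ?_ fun ξ => ?_
  · ext i j
    have := congrFun (congrFun hG i) j
    rw [Matrix.transpose_apply] at this
    simp [this]
  have h0 := hL.dotProduct_mulVec_nonneg fun r => c (r.1, r.2.1) * ξ r.2.2
  convert h0 using 1
  have expand : ∀ {ι : Type} [Fintype ι] (M : Matrix ι ι ℝ) (z : ι → ℝ),
      star z ⬝ᵥ M.mulVec z = ∑ i, ∑ j, z i * M i j * z j := by
    intro ι _ M z
    simp [dotProduct, Matrix.mulVec, Finset.mul_sum, mul_assoc]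
  rw [expand, expand]
  have key : ∀ z : Fin t, ∑ r : Expo n (k - halfDegree G) × (Fin m × Fin q),
      ∑ r' : Expo n (k - halfDegree G) × (Fin m × Fin q),
        c (r.1, r.2.1) * ξ r.2.2 * (Z (r.1, r.2.1) z * Z (r'.1, r'.2.1) z *
          MvPolynomial.eval (y z) (G r.2.2 r'.2.2)) * (c (r'.1, r'.2.1) * ξ r'.2.2) =
      if s = z then ∑ i, ∑ j, ξ i * MvPolynomial.eval (y z) (G i j) * ξ j else 0 := by
    intro z
    have inner : ∀ r : Expo n (k - halfDegree G) × (Fin m × Fin q),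
        ∑ r' : Expo n (k - halfDegree G) × (Fin m × Fin q),
        c (r.1, r.2.1) * ξ r.2.2 * (Z (r.1, r.2.1) z * Z (r'.1, r'.2.1) z *
          MvPolynomial.eval (y z) (G r.2.2 r'.2.2)) * (c (r'.1, r'.2.1) * ξ r'.2.2) =
        (c (r.1, r.2.1) * Z (r.1, r.2.1) z) * ((∑ r, c r * Z r z) *
          ∑ j, ξ r.2.2 * MvPolynomial.eval (y z) (G r.2.2 j) * ξ j) := by
      intro r
      rw [← sum_prod_mul, ← (Equiv.prodAssoc _ _ _).sum_comp, Finset.mul_sum]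
      refine Finset.sum_congr rfl fun r' _ => ?_
      simp only [Equiv.prodAssoc_apply]
      ring
    rw [Finset.sum_congr rfl fun r _ => inner r, ← (Equiv.prodAssoc _ _ _).sum_comp]
    simp only [Equiv.prodAssoc_apply, Prod.mk.eta]
    rw [sum_prod_mul (fun r => c r * Z r z)
      (fun i => (∑ r, c r * Z r z) * ∑ j, ξ i * MvPolynomial.eval (y z) (G i j) * ξ j), hc]
    split_ifs <;> simp
  calc _ = ∑ z : Fin t, if s = z then
        ∑ i, ∑ j, ξ i * MvPolynomial.eval (y z) (G i j) * ξ j else 0 := by simp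
    _ = ∑ z : Fin t, ∑ r : Expo n (k - halfDegree G) × (Fin m × Fin q),
      ∑ r' : Expo n (k - halfDegree G) × (Fin m × Fin q),
        c (r.1, r.2.1) * ξ r.2.2 * (Z (r.1, r.2.1) z * Z (r'.1, r'.2.1) z *
          MvPolynomial.eval (y z) (G r.2.2 r'.2.2)) * (c (r'.1, r'.2.1) * ξ r'.2.2) :=
        Finset.sum_congr rfl fun z _ => (key z).symm
    _ = _ := by
        rw [Finset.sum_comm]
        refine Finset.sum_congr rfl fun r _ => ?_
        rw [Finset.sum_comm]
        refine Finset.sum_congr rfl fun r' _ => ?_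
        rw [localizingMatrix_eq_sum hk h, Finset.mul_sum, Finset.sum_mul]

/-! ### Existence of a minimal representing measure -/

/-- Merging the dyads at equal points turns rank-one atoms, as many as the rank of the moment
matrix, into a minimal representing measure. -/
theorem exists_isAtomicRep_of_dyads {n m q k t : ℕ}
    {G : Matrix (Fin q) (Fin q) (MvPolynomial (Fin n) ℝ)}
    {S : (Fin n →₀ ℕ) → Matrix (Fin m) (Fin m) ℝ} (ht : t = (momentMatrix S k).rank)
    {y : Fin t → Fin n → ℝ} {u : Fin t → Fin m → ℝ}
    (hS : ∀ α : Fin n →₀ ℕ, α.degree ≤ 2 * k →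
      S α = ∑ s, mon α (y s) • Matrix.vecMulVec (u s) (u s))
    (hy : ∀ s, y s ∈ feasibleSet G) :
    ∃ (r : ℕ) (x : Fin r → Fin n → ℝ) (W : Fin r → Matrix (Fin m) (Fin m) ℝ),
      IsAtomicRep G S k x W := by
  classical
  obtain ⟨r, x, π, hx, hπ, hπs⟩ : ∃ (r : ℕ) (x : Fin r → Fin n → ℝ) (π : Fin t → Fin r),
      Function.Injective x ∧ (∀ s, x (π s) = y s) ∧ Function.Surjective π := by
    let e := (Finset.univ.image y).equivFin
    refine ⟨_, fun i => (e.symm i).1,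
      fun s => e ⟨y s, Finset.mem_image_of_mem y (Finset.mem_univ s)⟩,
      fun i j hij => e.symm.injective (Subtype.ext hij), fun s => by simp, fun i => ?_⟩
    obtain ⟨s, -, hs⟩ := Finset.mem_image.mp (e.symm i).2
    exact ⟨s, by simp [hs]⟩
  let W : Fin r → Matrix (Fin m) (Fin m) ℝ := fun i =>
    ∑ s ∈ Finset.univ.filter (fun s => π s = i), Matrix.vecMulVec (u s) (u s)
  have hmom : ∀ α : Fin n →₀ ℕ, α.degree ≤ 2 * k → S α = ∑ i, mon α (x i) • W i := by
    intro α hα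
    rw [hS α hα, ← Finset.sum_fiberwise Finset.univ π]
    refine Finset.sum_congr rfl fun i _ => ?_
    rw [Finset.smul_sum]
    refine Finset.sum_congr rfl fun s hs => ?_
    rw [← hπ s, (Finset.mem_filter.mp hs).2]
  have hpsd : ∀ i, (W i).PosSemidef := fun i =>
    Matrix.posSemidef_sum _ fun s _ => by simpa using Matrix.posSemidef_vecMulVec_self_star (u s)
  have hle : ∀ i, (W i).rank ≤ (Finset.univ.filter (fun s => π s = i)).card := fun i =>
    rank_sum_vecMulVec_le _ _
  have hcard : ∑ i, (Finset.univ.filter (fun s => π s = i)).card = t := by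
    rw [← Finset.card_eq_sum_card_fiberwise (f := π) (t := Finset.univ) (by simp)]
    simp
  have hrank : ∑ i, (W i).rank = t :=
    le_antisymm (hcard ▸ Finset.sum_le_sum fun i _ => hle i)
      (ht ▸ momentMatrix_rank_le hpsd hmom)
  refine ⟨r, x, W, ⟨hx, fun i => ?_, hpsd, fun i hi => ?_,
    (hasMoments_atomicMeasure_iff _ _ _ _).mpr hmom, hrank.trans ht⟩⟩
  · obtain ⟨s, rfl⟩ := hπs i
    exact hπ s ▸ hy s
  · -- Equality of the rank sums forces equality in each fibre, and no fibre is empty.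
    have heq := (Finset.sum_eq_sum_iff_of_le fun i _ => hle i).mp (hrank.trans hcard.symm) i
      (Finset.mem_univ i)
    obtain ⟨s, hs⟩ := hπs i
    rw [hi, Matrix.rank_zero] at heq
    have : s ∈ Finset.univ.filter (fun s => π s = i) := by simp [hs]
    rw [Finset.card_eq_zero.mp heq.symm] at this
    simp at this

theorem exists_isAtomicRep {n m q k : ℕ}
    {G : Matrix (Fin q) (Fin q) (MvPolynomial (Fin n) ℝ)} (hG : G.IsSymm)
    {S : (Fin n →₀ ℕ) → Matrix (Fin m) (Fin m) ℝ}
    (hdG : 1 ≤ halfDegree G) (hk : halfDegree G ≤ k) (hM : (momentMatrix S k).PosSemidef)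
    (hL : (localizingMatrix G S (k - halfDegree G)).PosSemidef)
    (hflat : (momentMatrix S k).rank = (momentMatrix S (k - halfDegree G)).rank) :
    ∃ (r : ℕ) (x : Fin r → Fin n → ℝ) (W : Fin r → Matrix (Fin m) (Fin m) ℝ),
      IsAtomicRep G S k x W := by
  obtain ⟨y, u, hS, hc⟩ := exists_dyadic_atoms hdG hk hM hflat
  refine exists_isAtomicRep_of_dyads rfl hS fun s => ?_
  obtain ⟨c, hc⟩ := hc s
  exact mem_feasibleSet_of_localizing hG hk hS hL hc

/-! ### The pivot rows and the multiplication matrices -/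

theorem eq_zero_of_mulVec_eq_zero_of_rank {ι I : Type*} [Finite ι] [Fintype I]
    {V : Matrix ι I ℝ} (h : Fintype.card I ≤ V.rank) {c : I → ℝ} (hc : V.mulVec c = 0) :
    c = 0 := by
  have h1 := LinearMap.finrank_range_add_finrank_ker V.mulVecLin
  rw [Module.finrank_fintype_fun_eq_card] at h1
  have h2 : V.rank = Module.finrank ℝ (LinearMap.range V.mulVecLin) := rfl
  have h3 : LinearMap.ker V.mulVecLin = ⊥ := Submodule.finrank_eq_zero.mp (by omega)
  have h4 : c ∈ LinearMap.ker V.mulVecLin := hc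
  rwa [h3, Submodule.mem_bot] at h4

theorem range_mulVecLin_of_eq_mul_transpose {ι I : Type*} [Fintype ι] [Fintype I]
    {M : Matrix ι ι ℝ} {V : Matrix ι I ℝ} (h : M = V * V.transpose) :
    LinearMap.range V.mulVecLin = LinearMap.range M.mulVecLin := by
  symm
  refine Submodule.eq_of_le_of_finrank_eq ?_ ?_
  · rw [h, Matrix.mulVecLin_mul]
    exact LinearMap.range_comp_le_range _ _
  · change M.rank = V.rank
    rw [h, Matrix.rank_self_mul_transpose]

/-- By flatness the rows of `U` of degree at most `k - d` have full rank. A pivot of higher degree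
would make its column vanish on all of these rows. -/
theorem pivot_degree_le {n m k d t : ℕ} {S : (Fin n →₀ ℕ) → Matrix (Fin m) (Fin m) ℝ}
    (ht : t = (momentMatrix S (k - d)).rank)
    {V U : Matrix (Expo n k × Fin m) (Fin t) ℝ} {p : Fin t → Expo n k × Fin m}
    (hV : momentMatrix S k = V * V.transpose) (hVU : ColumnEquivalent V U)
    (hU : IsColumnEchelon U p) (a : Fin t) : (p a).1.1.degree ≤ k - d := by
  by_contra! hlt
  obtain ⟨Q, hQ, rfl⟩ := hVU
  let inc : Expo n (k - d) × Fin m → Expo n k × Fin m := fun r =>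
    (⟨r.1.1, r.1.2.trans (Nat.sub_le _ _)⟩, r.2)
  let V' : Matrix (Expo n (k - d) × Fin m) (Fin t) ℝ := V.submatrix inc id
  have hV' : momentMatrix S (k - d) = V' * V'.transpose := by
    ext r s
    exact congrFun (congrFun hV (inc r)) (inc s)
  have hrank : Fintype.card (Fin t) ≤ V'.rank := by
    rw [Fintype.card_fin, ← Matrix.rank_self_mul_transpose, ← hV', ← ht]
  have hzero : V'.mulVec (Q.mulVec (Pi.single a 1)) = 0 := by
    rw [Matrix.mulVec_mulVec]
    ext r
    rw [Matrix.mulVec_single_one]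
    exact hU.zero_above (inc r) a (Or.inl (Or.inl (lt_of_le_of_lt r.1.2 hlt)))
  have h1 := eq_zero_of_mulVec_eq_zero_of_rank hrank hzero
  have h2 := Matrix.mulVec_injective_of_isUnit hQ (h1.trans (Matrix.mulVec_zero Q).symm)
  simpa using congrFun h2 a

/-- `U` expresses every monomial `x^α w_j` through the pivot monomials, at each atom. -/
theorem mulVec_basisVec {n m k t : ℕ} {I : Type*} [Fintype I]
    {S : (Fin n →₀ ℕ) → Matrix (Fin m) (Fin m) ℝ}
    {x : I → Fin n → ℝ} {w : I → Fin m → ℝ}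
    (hZ : momentMatrix S k = atomMatrix k x w * (atomMatrix k x w).transpose)
    {V U : Matrix (Expo n k × Fin m) (Fin t) ℝ} {p : Fin t → Expo n k × Fin m}
    (hV : momentMatrix S k = V * V.transpose) (hVU : ColumnEquivalent V U)
    (hU : IsColumnEchelon U p) (s : I) :
    U.mulVec (basisVec p (x s) (w s)) = (atomMatrix k x w).col s := by
  classical
  obtain ⟨Q, hQ, rfl⟩ := hVU
  have hmem : (atomMatrix k x w).col s ∈ LinearMap.range V.mulVecLin := by
    rw [range_mulVecLin_of_eq_mul_transpose hV, ← range_mulVecLin_of_eq_mul_transpose hZ]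
    exact ⟨Pi.single s 1, by simp⟩
  obtain ⟨c, hc⟩ := hmem
  have hQQ : Q * Q⁻¹ = 1 := Matrix.mul_nonsing_inv _ ((Matrix.isUnit_iff_isUnit_det _).mp hQ)
  have hb : (V * Q).mulVec (Q⁻¹.mulVec c) = (atomMatrix k x w).col s := by
    rw [Matrix.mulVec_mulVec, Matrix.mul_assoc, hQQ, Matrix.mul_one]
    exact hc
  convert hb using 2
  ext a
  have h := congrFun hb (p a)
  rw [Matrix.mulVec, dotProduct] at h
  simp only [hU.pivot_rows] at h
  simpa [atomMatrix, basisVec] using h.symm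

theorem multMatrix_mulVec_basisVec {n m k t : ℕ} {I : Type*} [Fintype I]
    {x : I → Fin n → ℝ} {w : I → Fin m → ℝ}
    {U : Matrix (Expo n k × Fin m) (Fin t) ℝ} {p : Fin t → Expo n k × Fin m}
    (hp : ∀ a, (p a).1.1.degree + 1 ≤ k) {s : I}
    (hU : U.mulVec (basisVec p (x s) (w s)) = (atomMatrix k x w).col s) (l : Fin n) :
    (multMatrix U p l).mulVec (basisVec p (x s) (w s)) = x s l • basisVec p (x s) (w s) := by
  ext a
  -- The shifted pivot row exists, so the default value in `multMatrix` is not met.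
  have hdeg : ((p a).1.1 + Finsupp.single l 1).degree ≤ k := by
    rw [map_add, Finsupp.degree_single]
    exact hp a
  have h := congrFun hU (⟨(p a).1.1 + Finsupp.single l 1, hdeg⟩, (p a).2)
  have hrow : (multMatrix U p l).mulVec (basisVec p (x s) (w s)) a =
      U.mulVec (basisVec p (x s) (w s)) (⟨(p a).1.1 + Finsupp.single l 1, hdeg⟩, (p a).2) := by
    simp only [Matrix.mulVec, multMatrix, Matrix.of_apply, hdeg, dif_pos]
  rw [hrow, h]
  simp only [Matrix.col_apply, atomMatrix, Matrix.of_apply, mon_add, mon_single, Pi.smul_apply,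
    basisVec, smul_eq_mul]
  ring

theorem linearIndependent_basisVec {n m k t : ℕ} {I : Type*} [Fintype I]
    {S : (Fin n →₀ ℕ) → Matrix (Fin m) (Fin m) ℝ}
    {x : I → Fin n → ℝ} {w : I → Fin m → ℝ}
    (hZ : momentMatrix S k = atomMatrix k x w * (atomMatrix k x w).transpose)
    (hI : Fintype.card I ≤ (momentMatrix S k).rank)
    {U : Matrix (Expo n k × Fin m) (Fin t) ℝ} {p : Fin t → Expo n k × Fin m}
    (hU : ∀ s, U.mulVec (basisVec p (x s) (w s)) = (atomMatrix k x w).col s) :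
    LinearIndependent ℝ fun s => basisVec p (x s) (w s) := by
  rw [Fintype.linearIndependent_iff]
  intro g hg
  rw [hZ, Matrix.rank_self_mul_transpose] at hI
  have h0 : (atomMatrix k x w).mulVec g = 0 := by
    have h := congrArg U.mulVecLin hg
    rw [map_sum, map_zero] at h
    simp only [map_smul, Matrix.mulVecLin_apply, hU] at h
    rw [← h]
    ext r
    simp [Matrix.mulVec, dotProduct, mul_comm]
  exact fun s => congrFun (eq_zero_of_mulVec_eq_zero_of_rank hI h0) s

/-! ### Reading the atoms off a Schur decomposition -/

theorem sum_smul_mul_eq {n t : ℕ} {N : Fin n → Matrix (Fin t) (Fin t) ℝ}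
    {B : Matrix (Fin t) (Fin t) ℝ} {z : Fin t → Fin n → ℝ}
    (hN : ∀ l, N l * B = B * Matrix.diagonal fun j => z j l) (c : Fin n → ℝ) :
    (∑ l, c l • N l) * B = B * Matrix.diagonal fun j => ∑ l, c l * z j l := by
  rw [Finset.sum_mul]
  simp only [smul_mul_assoc, hN]
  ext i j
  simp [Matrix.sum_apply, Matrix.mul_diagonal, Finset.mul_sum, mul_left_comm]

/-- Let the `N l` have a common eigenbasis, with joint eigenvalues `z j`, on which the combination
`∑ c l • N l` has separate eigenvalues for separate `z j`. Then each `N l` is a polynomial in that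
combination, by interpolation, so an ordered Schur basis `A` of the combination triangularizes all
`N l`, and their diagonal entries are the joint eigenvalues. -/
theorem quadPoint_col_eq {n t : ℕ} {N : Fin n → Matrix (Fin t) (Fin t) ℝ}
    {B : Matrix (Fin t) (Fin t) ℝ} (hB : IsUnit B) {z : Fin t → Fin n → ℝ}
    (hN : ∀ l, N l * B = B * Matrix.diagonal fun j => z j l) {c : Fin n → ℝ}
    (hz : ∀ i j, ∑ l, c l * z i l = ∑ l, c l * z j l → z i = z j)
    (hmono : Monotone fun j => ∑ l, c l * z j l)
    {A T : Matrix (Fin t) (Fin t) ℝ} (hS : IsOrderedSchur (∑ l, c l • N l) A T) (j : Fin t) :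
    quadPoint N (A.col j) = z j := by
  let d : Fin t → ℝ := fun j => ∑ l, c l * z j l
  have hNB : (∑ l, c l • N l) * B = B * Matrix.diagonal d := sum_smul_mul_eq hN c
  have hA : IsUnit A := IsUnit.of_mul_eq_one_right _ hS.orthogonal
  have hT : T.IsUpperTriangular := fun i j hij => hS.upper i j hij
  have hNA : (∑ l, c l • N l) * A = A * T := by
    rw [hS.eq, mul_assoc, hS.orthogonal, mul_one]
  -- Both diagonals are sorted, so they agree entry by entry.
  have hdiag : (fun j => T j j) = d := by
    have h := map_diag_eq hA hT hNA hB hNB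
    rw [Fin.univ_val_map, Fin.univ_val_map, Multiset.coe_eq_coe] at h
    exact List.ofFn_injective (h.eq_of_sortedLE hS.sorted.sortedLE_ofFn hmono.sortedLE_ofFn)
  ext l
  -- A polynomial `P` with `N l = P(∑ c l • N l)`.
  obtain ⟨P, hP⟩ : ∃ P : Polynomial ℝ, ∀ j, P.eval (d j) = z j l := by
    let g : ℝ → ℝ := Function.extend d (fun j => z j l) 0
    have hg : ∀ j, g (d j) = z j l := fun j =>
      Function.FactorsThrough.extend_apply (fun i j hij => by rw [hz i j hij]) _ j
    refine ⟨Lagrange.interpolate (Finset.univ.image d) id g, fun j => ?_⟩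
    have := Lagrange.eval_interpolate_at_node (s := Finset.univ.image d) (v := id) g
      (Function.injective_id.injOn) (Finset.mem_image_of_mem d (Finset.mem_univ j))
    rw [← hg j]
    exact this
  have hNl : Polynomial.aeval (∑ l, c l • N l) P = N l := by
    refine hB.mul_right_cancel ?_
    rw [aeval_mul_eq_mul_aeval hNB, hN, aeval_diagonal_apply]
    simp only [hP]
  calc quadPoint N (A.col j) l = (A.transpose * (N l * A)) j j := by
        simp only [quadPoint, Matrix.mul_apply, dotProduct, Matrix.mulVec, Matrix.col_apply,
          Matrix.transpose_apply]
    _ = z j l := by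
        rw [← hNl, aeval_mul_eq_mul_aeval hNA, ← mul_assoc, hS.orthogonal, one_mul,
          (aeval_upper hT P).2, ← hP]
        exact congrArg (fun v => P.eval v) (congrFun hdiag j)

/-- Independent dyadic atoms with joint eigenvector relations, as many as the size of the matrices,
yield an ordered Schur decomposition, and every such decomposition lists the points of the atoms
with their multiplicities. -/
theorem schur_of_eigenvectors {n t : ℕ} {I : Type*} [Fintype I] (hI : Fintype.card I = t)
    {N : Fin n → Matrix (Fin t) (Fin t) ℝ} {x : I → Fin n → ℝ} {b : I → Fin t → ℝ}
    (hb : LinearIndependent ℝ b) (hN : ∀ s l, (N l).mulVec (b s) = x s l • b s) {c : Fin n → ℝ}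
    (hx : ∀ s s', ∑ l, c l * x s l = ∑ l, c l * x s' l → x s = x s') :
    (∃ A T, IsOrderedSchur (∑ l, c l • N l) A T) ∧
      ∀ A T, IsOrderedSchur (∑ l, c l • N l) A T →
        ∃ σ : Fin t ≃ I, ∀ j, quadPoint N (A.col j) = x (σ j) := by
  let e := (Fintype.equivFinOfCardEq hI).symm
  let σ : Fin t ≃ I := (Tuple.sort fun j => ∑ l, c l * x (e j) l).trans e
  have hmono : Monotone fun j => ∑ l, c l * x (σ j) l :=
    Tuple.monotone_sort fun j => ∑ l, c l * x (e j) l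
  let B : Matrix (Fin t) (Fin t) ℝ := Matrix.of fun i j => b (σ j) i
  have hB : IsUnit B := by
    have h : LinearIndependent ℝ B.col := hb.comp σ σ.injective
    exact Matrix.linearIndependent_cols_iff_isUnit.mp h
  have hNB : ∀ l, N l * B = B * Matrix.diagonal fun j => x (σ j) l := by
    intro l
    ext i j
    have h := congrFun (hN (σ j) l) i
    rw [Matrix.mul_diagonal, Matrix.mul_apply]
    simp only [Matrix.mulVec, dotProduct, Pi.smul_apply, smul_eq_mul] at h
    simp only [B, Matrix.of_apply, h]
    ring
  refine ⟨exists_orderedSchur hB hmono (sum_smul_mul_eq hNB c), fun A T hS => ⟨σ, fun j => ?_⟩⟩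
  exact quadPoint_col_eq hB (z := fun j => x (σ j)) hNB (fun _ _ => hx _ _) hmono hS j

/-- Dyadic decompositions of the weights of a minimal representing measure factor the moment matrix
through a matrix with as many columns as its rank. -/
theorem IsAtomicRep.momentMatrix_eq {n m q r k : ℕ}
    {G : Matrix (Fin q) (Fin q) (MvPolynomial (Fin n) ℝ)}
    {S : (Fin n →₀ ℕ) → Matrix (Fin m) (Fin m) ℝ} {x : Fin r → Fin n → ℝ}
    {W : Fin r → Matrix (Fin m) (Fin m) ℝ} (h : IsAtomicRep G S k x W)
    {w : (i : Fin r) → Fin (W i).rank → Fin m → ℝ}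
    (hw : ∀ i, W i = ∑ j, Matrix.vecMulVec (w i j) (w i j)) :
    momentMatrix S k =
      atomMatrix k (fun ij : (i : Fin r) × Fin (W i).rank => x ij.1) (fun ij => w ij.1 ij.2) *
        (atomMatrix k (fun ij : (i : Fin r) × Fin (W i).rank => x ij.1)
          (fun ij => w ij.1 ij.2)).transpose :=
  momentMatrix_eq_atomMatrix fun α hα => by
    rw [(hasMoments_atomicMeasure_iff _ _ _ _).mp h.moments α hα, sum_sigma_dyads hw]

end MatrixMoment

end

theorem mainTheorem2 {n m q : ℕ} (k : ℕ)
    (G : Matrix (Fin q) (Fin q) (MvPolynomial (Fin n) ℝ)) (hG : G.IsSymm)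
    (S : (Fin n →₀ ℕ) → Matrix (Fin m) (Fin m) ℝ)
    (hS : ∀ α : Fin n →₀ ℕ, α.degree ≤ 2 * k → (S α).IsSymm)
    (hdG : 1 ≤ MatrixMoment.halfDegree G) (hk : MatrixMoment.halfDegree G ≤ k)
    (hM : (MatrixMoment.momentMatrix S k).PosSemidef)
    (hL : (MatrixMoment.localizingMatrix G S (k - MatrixMoment.halfDegree G)).PosSemidef)
    (hflat : (MatrixMoment.momentMatrix S k).rank =
      (MatrixMoment.momentMatrix S (k - MatrixMoment.halfDegree G)).rank) :
    (∃ (r : ℕ) (x : Fin r → Fin n → ℝ) (W : Fin r → Matrix (Fin m) (Fin m) ℝ),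
      MatrixMoment.IsAtomicRep G S k x W) ∧
    ∀ (r : ℕ) (x : Fin r → Fin n → ℝ) (W : Fin r → Matrix (Fin m) (Fin m) ℝ),
      MatrixMoment.IsAtomicRep G S k x W →
    ∀ (t : ℕ), t = (MatrixMoment.momentMatrix S k).rank →
    ∀ (V U : Matrix (MatrixMoment.Expo n k × Fin m) (Fin t) ℝ)
      (p : Fin t → MatrixMoment.Expo n k × Fin m),
      MatrixMoment.momentMatrix S k = V * V.transpose →
      MatrixMoment.ColumnEquivalent V U →
      MatrixMoment.IsColumnEchelon U p →
      -- the rows of `U` that define the multiplication matrices exist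
      (∀ a, (p a).1.1.degree ≤ k - MatrixMoment.halfDegree G) ∧
      -- for every rank decomposition of the weights: multiplication relations and independence
      (∀ w : (i : Fin r) → Fin (W i).rank → Fin m → ℝ,
        (∀ i, W i = ∑ j, Matrix.vecMulVec (w i j) (w i j)) →
        (∀ i j l, Matrix.mulVec (MatrixMoment.multMatrix U p l)
            (MatrixMoment.basisVec p (x i) (w i j)) =
          x i l • MatrixMoment.basisVec p (x i) (w i j)) ∧
        LinearIndependent ℝ (fun ij : (i : Fin r) × Fin (W i).rank =>
          MatrixMoment.basisVec p (x ij.1) (w ij.1 ij.2))) ∧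
      ∀ c : Fin n → ℝ, (∀ l, 0 < c l) → ∑ l, c l = 1 →
        Function.Injective (fun i => ∑ l, c l * x i l) →
        (∃ A T : Matrix (Fin t) (Fin t) ℝ,
          MatrixMoment.IsOrderedSchur (∑ l, c l • MatrixMoment.multMatrix U p l) A T) ∧
        ∀ A T : Matrix (Fin t) (Fin t) ℝ,
          MatrixMoment.IsOrderedSchur (∑ l, c l • MatrixMoment.multMatrix U p l) A T →
          Set.range (fun j => MatrixMoment.quadPoint (MatrixMoment.multMatrix U p) (A.col j)) =
            Set.range x ∧
          ∀ i, Nat.card {j : Fin t //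
            MatrixMoment.quadPoint (MatrixMoment.multMatrix U p) (A.col j) = x i} =
              (W i).rank := by
  classical
  refine ⟨MatrixMoment.exists_isAtomicRep hG hdG hk hM hL hflat, ?_⟩
  intro r x W hrep t ht V U p hV hVU hU
  have hp : ∀ a, (p a).1.1.degree ≤ k - MatrixMoment.halfDegree G :=
    MatrixMoment.pivot_degree_le (ht.trans hflat) hV hVU hU
  have hp' : ∀ a, (p a).1.1.degree + 1 ≤ k := fun a => by
    have := hp a
    omega
  have hcard : Fintype.card ((i : Fin r) × Fin (W i).rank) =
      (MatrixMoment.momentMatrix S k).rank := by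
    rw [← hrep.rank_eq]
    simp
  have hmul : ∀ w : (i : Fin r) → Fin (W i).rank → Fin m → ℝ,
      (∀ i, W i = ∑ j, Matrix.vecMulVec (w i j) (w i j)) →
      ∀ (ij : (i : Fin r) × Fin (W i).rank) (l : Fin n),
        Matrix.mulVec (MatrixMoment.multMatrix U p l)
          (MatrixMoment.basisVec p (x ij.1) (w ij.1 ij.2)) =
        x ij.1 l • MatrixMoment.basisVec p (x ij.1) (w ij.1 ij.2) := fun w hw ij l =>
    MatrixMoment.multMatrix_mulVec_basisVec (x := fun ij : (i : Fin r) × Fin (W i).rank => x ij.1)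
      (w := fun ij => w ij.1 ij.2) hp'
      (MatrixMoment.mulVec_basisVec (hrep.momentMatrix_eq hw) hV hVU hU ij) l
  have hind : ∀ w : (i : Fin r) → Fin (W i).rank → Fin m → ℝ,
      (∀ i, W i = ∑ j, Matrix.vecMulVec (w i j) (w i j)) →
      LinearIndependent ℝ (fun ij : (i : Fin r) × Fin (W i).rank =>
        MatrixMoment.basisVec p (x ij.1) (w ij.1 ij.2)) := fun w hw =>
    MatrixMoment.linearIndependent_basisVec (hrep.momentMatrix_eq hw) hcard.le
      (MatrixMoment.mulVec_basisVec (hrep.momentMatrix_eq hw) hV hVU hU)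
  refine ⟨hp, fun w hw => ⟨fun i j l => hmul w hw ⟨i, j⟩ l, hind w hw⟩, ?_⟩
  intro c _ _ hinj
  choose w hw using fun i => MatrixMoment.exists_sum_vecMulVec_of_posSemidef (hrep.psd i)
  obtain ⟨hex, hall⟩ := MatrixMoment.schur_of_eigenvectors (hcard.trans ht.symm) (hind w hw)
    (x := fun ij : (i : Fin r) × Fin (W i).rank => x ij.1) (hmul w hw) (c := c)
    fun s s' h => congrArg x (hinj h)
  refine ⟨hex, fun A T hS => ?_⟩
  obtain ⟨σ, hσ⟩ := hall A T hS
  -- A nonzero weight has positive rank, so no point of the measure is missed.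
  have hpos : ∀ i, 0 < (W i).rank := by
    intro i
    rw [Nat.pos_iff_ne_zero]
    intro h0
    have : IsEmpty (Fin (W i).rank) := by rw [h0]; infer_instance
    refine hrep.ne_zero i ?_
    rw [hw i]
    exact Fintype.sum_empty _
  refine ⟨?_, fun i => ?_⟩
  · ext y
    constructor
    · rintro ⟨j, rfl⟩
      exact ⟨(σ j).1, (hσ j).symm⟩
    · rintro ⟨i, rfl⟩
      refine ⟨σ.symm ⟨i, ⟨0, hpos i⟩⟩, ?_⟩
      change MatrixMoment.quadPoint _ _ = _
      rw [hσ, Equiv.apply_symm_apply]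
  · calc _ = Nat.card {s : (i : Fin r) × Fin (W i).rank // s.1 = i} :=
          Nat.card_congr (σ.subtypeEquiv fun j => by rw [hσ, hrep.distinct.eq_iff])
      _ = _ := by rw [Nat.card_congr (Equiv.sigmaSubtype i), Nat.card_fin]
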